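/- Let $\alpha_0,\alpha_1,\alpha_2,\alpha_3$ be proper (orientation preserving) Euclidean displacements of three-space that form a rotation quadrangle: every relative displacement $\tau_{i,i+1}=\alpha_{i+1}\circ\alpha_i^{-1}$ (indices modulo four) is a pure rotation, that is, a proper displacement different from the identity with a fixed point. Let $r_{i,i+1}=\{X : \alpha_i(X)=\alpha_{i+1}(X)\}$ be the relative revolute axes in the moving space. Assume that the quadrangle is generic: the images of $\alpha_0,\dots,\alpha_3$ under Study's kinematic mapping span a projective three-space (that is, their Study parameter vectors are linearly independent) which is not contained in the Study quadric. A common transversal is a straight line that meets each of the four axes, possibly at infinity (that is, for each axis it has a point in common with it or is parallel to it). Let $\mathcal{L}$ be the locus of those points $X$ of the (real) moving space whose four homologous images $\alpha_0(X),\alpha_1(X),\alpha_2(X),\alpha_3(X)$ lie on a circle, straight lines being counted as circles. Then the four sets $r_{01},r_{12},r_{23},r_{30}$ are straight lines, and $\mathcal{L}$ is exactly the union of these four lines and of all their common transversals. In particular, if the four axes have exactly two common transversals $u\neq v$, then the six lines $r_{01},r_{12},r_{23},r_{30},u,v$ are pairwise distinct and \[ \mathcal{L}=r_{01}\cup r_{12}\cup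 r_{23}\cup r_{30}\cup u\cup v . \] -/

import Mathlib

open scoped Quaternion

noncomputable section

namespace RotationQuadrangle

/-- Euclidean three-space, used both for the moving and for the fixed space. -/
abbrev E3 : Type := EuclideanSpace ℝ (Fin 3)

/-- A proper Euclidean displacement: an isometry whose linear part has determinant one. -/
def IsProper (σ : E3 ≃ᵃⁱ[ℝ] E3) : Prop :=
  LinearMap.det (σ.linearIsometryEquiv.toLinearEquiv : E3 →ₗ[ℝ] E3) = 1

/-- A pure rotation: a proper displacement, different from the identity, with a fixed point
(so that its fixed points form a straight line, the axis). -/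
def IsPureRotation (σ : E3 ≃ᵃⁱ[ℝ] E3) : Prop :=
  IsProper σ ∧ σ ≠ AffineIsometryEquiv.refl ℝ E3 ∧ ∃ x, σ x = x

/-- The affine subspace of fixed points of a displacement; for a pure rotation, its axis. -/
def fixedSpace (σ : E3 ≃ᵃⁱ[ℝ] E3) : AffineSubspace ℝ E3 where
  carrier := {x | σ x = x}
  smul_vsub_vadd_mem' c p₁ p₂ p₃ h₁ h₂ h₃ := by
    simp only [Set.mem_ofPred_eq] at h₁ h₂ h₃ ⊢
    rw [AffineIsometryEquiv.map_vadd, map_smul, AffineIsometryEquiv.map_vsub, h₁, h₂, h₃]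

/-- The relative displacement `τ i = α (i + 1) ∘ (α i)⁻¹`, with indices modulo four. -/
def relDisplacement (α : Fin 4 → E3 ≃ᵃⁱ[ℝ] E3) (i : Fin 4) : E3 ≃ᵃⁱ[ℝ] E3 :=
  (α i).symm.trans (α (i + 1))

/-- Four proper displacements whose consecutive relative displacements are pure rotations. -/
def IsRotationQuadrangle (α : Fin 4 → E3 ≃ᵃⁱ[ℝ] E3) : Prop :=
  (∀ i, IsProper (α i)) ∧ ∀ i, IsPureRotation (relDisplacement α i)

/-- The relative revolute axis in the moving space: the preimage under `α i` of the axis of the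
relative rotation `τ i`. -/
def relAxis (α : Fin 4 → E3 ≃ᵃⁱ[ℝ] E3) (i : Fin 4) : AffineSubspace ℝ E3 :=
  (fixedSpace (relDisplacement α i)).comap (α i).toAffineEquiv.toAffineMap

/-- A set of points lies on a circle, straight lines being counted as circles. -/
def OnCircle (s : Set E3) : Prop :=
  EuclideanGeometry.Concyclic s ∨ Collinear ℝ s

/-- The points of the moving space whose four homologous images lie on a circle. -/
def circleLocus (α : Fin 4 → E3 ≃ᵃⁱ[ℝ] E3) : Set E3 :=
  {x | OnCircle (Set.range fun i => α i x)}

/-- A straight line. -/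
def IsLine (u : AffineSubspace ℝ E3) : Prop :=
  (u : Set E3).Nonempty ∧ Module.finrank ℝ u.direction = 1

/-- The common transversals of the four relative revolute axes: the straight lines that meet each
of them, possibly at infinity (that is, being parallel to it). -/
def transversals (α : Fin 4 → E3 ≃ᵃⁱ[ℝ] E3) : Set (AffineSubspace ℝ E3) :=
  {u | IsLine u ∧
    ∀ i, ((u : Set E3) ∩ (relAxis α i : Set E3)).Nonempty ∨ u.Parallel (relAxis α i)}

/-- The identification of three-space with the purely imaginary quaternions. -/
def vecQuat (x : E3) : ℍ[ℝ] := ⟨0, x 0, x 1, x 2⟩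

/-- (The cone over) the Study quadric, in the space of dual quaternions `P + ε D`,
written as pairs `(P, D)`. -/
def studyQuadric : Set (ℍ[ℝ] × ℍ[ℝ]) := {A | (A.1 * star A.2).re = 0}

/-- `A = P + ε D` is a Study parameter vector of the displacement `σ`: it lies on the Study
quadric, `P` is not zero, and `σ x = (P x P* + 2 D P*) / |P|²`. It is determined by `σ` up to a
nonzero real factor. -/
def IsStudyVector (A : ℍ[ℝ] × ℍ[ℝ]) (σ : E3 ≃ᵃⁱ[ℝ] E3) : Prop :=
  A ∈ studyQuadric ∧ A.1 ≠ 0 ∧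
    ∀ x, Quaternion.normSq A.1 • vecQuat (σ x) =
      A.1 * vecQuat x * star A.1 + (2 : ℝ) • (A.2 * star A.1)

/-- The genericity assumption: the images of the four displacements under Study's kinematic
mapping span a projective three-space that is not contained in the Study quadric. -/
def IsGeneric (α : Fin 4 → E3 ≃ᵃⁱ[ℝ] E3) : Prop :=
  ∃ A : Fin 4 → ℍ[ℝ] × ℍ[ℝ], (∀ i, IsStudyVector (A i) (α i)) ∧ LinearIndependent ℝ A ∧
    ¬ ((Submodule.span ℝ (Set.range A) : Set (ℍ[ℝ] × ℍ[ℝ])) ⊆ studyQuadric)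

end RotationQuadrangle

end

/-!
The points of the moving space are treated one at a time. Fix `x`, let `y i = α i x` be its four
images, `v i = y (i + 1) - y i` the sides of the quadrangle of images, and `P i` the primal part
of a Study parameter vector of `α i`, all vectors being read as imaginary quaternions. Put
`n i = star (P i) * v i * P (i + 1)`. This is an imaginary quaternion, namely the moment of `x`
about the `i`-th relative axis (`star_mul_sub_mul`, `exists_relAxis_eq_line`). It vanishes exactly
if `x` lies on that axis, in which case two images coincide and `x` is in the locus. Otherwise it
is a normal vector of the plane joining `x` with the axis, so that the line through `x` with
direction `d` meets the axis, possibly at infinity, if and only if `d` is orthogonal to `n i`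
(`meets_line_iff`).

For `x` outside the axes, the images lie on a circle or a line if and only if the product
`v 0 * v 1 * v 2 * v 3` is real (`onCircle_iff_im_eq_zero`); up to a real factor this is their
quaternionic cross ratio. The product `n 0 * n 1 * n 2 * n 3` equals
`star (P 0) * (v 0 * v 1 * v 2 * v 3) * P 0` up to a positive factor, so that one of the two
products is real if and only if the other is.

* If the product is real, then `n 0 * n 1` and `n 3 * n 2` are real multiples of each other, which
  leaves a direction orthogonal to all four `n i` (`exists_common_orthogonal`): there is a common
  transversal through `x`.
* Conversely let `d` be orthogonal to all `n i`, and let `δ i = P i * d * (P i)⁻¹` be the images of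
  this direction. Then `δ (i + 1)` is the mirror image of `δ i` in the plane orthogonal to `v i`, so
  `δ (i + 1) - δ i = s i • v i` with real `s i`. If the product of the sides is not real, then all
  `s i` agree: in a skew quadrangle by linear independence of three sides, in a plane one because
  `δ 0` is parallel to the imaginary part of the product, hence orthogonal to all sides. Thus
  `δ i - s • y i` does not depend on `i`. Geometrically, all four axes pass through one point,
  possibly at infinity, and a computation shows that the Study parameter vectors are pairwise
  conjugate with respect to the Study quadric (`re_mul_star_mul_sub_eq_zero`, `two_mul_polar`).
  Their span is then contained in the quadric, which genericity excludes.

That the six lines are distinct if there are exactly two transversals `u` and `v` is a fact about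
four arbitrary lines (`injective_of_transversals_eq_pair`). If one of the four were `u`, it would
meet `v`, and every line of the pencil spanned by `u` and `v` would be a transversal. If two of
them coincided, there would be a transversal through each of their points.
-/

namespace RotationQuadrangle

/-! ### Imaginary quaternions and vectors -/

@[simp] theorem vecQuat_re (x : E3) : (vecQuat x).re = 0 := rfl
@[simp] theorem vecQuat_imI (x : E3) : (vecQuat x).imI = x 0 := rfl
@[simp] theorem vecQuat_imJ (x : E3) : (vecQuat x).imJ = x 1 := rfl
@[simp] theorem vecQuat_imK (x : E3) : (vecQuat x).imK = x 2 := rfl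

theorem vecQuat_sub (a b : E3) : vecQuat (a - b) = vecQuat a - vecQuat b := by
  ext <;> simp

theorem vecQuat_add (a b : E3) : vecQuat (a + b) = vecQuat a + vecQuat b := by
  ext <;> simp

theorem vecQuat_smul (k : ℝ) (a : E3) : vecQuat (k • a) = k • vecQuat a := by
  ext <;> simp

theorem exists_vecQuat_eq {q : ℍ[ℝ]} (h : q.re = 0) : ∃ x, vecQuat x = q := by
  refine ⟨!₂[q.imI, q.imJ, q.imK], ?_⟩
  ext <;> simp [h]

theorem vecQuat_injective : Function.Injective vecQuat := by
  intro x y h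
  ext i
  fin_cases i
  · exact congrArg QuaternionAlgebra.imI h
  · exact congrArg QuaternionAlgebra.imJ h
  · exact congrArg QuaternionAlgebra.imK h

theorem vecQuat_eq_zero_iff {x : E3} : vecQuat x = 0 ↔ x = 0 := by
  have h0 : vecQuat 0 = 0 := by ext <;> simp
  rw [← h0, vecQuat_injective.eq_iff]

theorem normSq_vecQuat_sub (p o : E3) :
    Quaternion.normSq (vecQuat p - vecQuat o) = dist p o ^ 2 := by
  rw [dist_eq_norm, EuclideanSpace.norm_sq_eq, Fin.sum_univ_three]
  simp [Quaternion.normSq_def']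

theorem star_eq_neg_of_re {q : ℍ[ℝ]} (h : q.re = 0) : star q = -q :=
  Quaternion.star_eq_neg.2 h

theorem mul_self_of_re {a : ℍ[ℝ]} (ha : a.re = 0) :
    a * a = ((-(Quaternion.normSq a) : ℝ) : ℍ[ℝ]) := by
  have := Quaternion.self_mul_star a
  rw [star_eq_neg_of_re ha] at this
  simp [← this]

/-- Commuting imaginary quaternions are parallel vectors. -/
theorem exists_smul_of_commute {a b : ℍ[ℝ]} (ha : a.re = 0) (hb : b.re = 0) (h0 : a ≠ 0)
    (h : a * b = b * a) : ∃ k : ℝ, b = k • a := by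
  have hN : Quaternion.normSq a ≠ 0 := Quaternion.normSq_ne_zero.2 h0
  have h1 := congrArg QuaternionAlgebra.imI h
  have h2 := congrArg QuaternionAlgebra.imJ h
  have h3 := congrArg QuaternionAlgebra.imK h
  simp [ha, hb] at h1 h2 h3
  have key : Quaternion.normSq a • b = (-(a * b).re) • a := by
    ext <;> simp [Quaternion.normSq_def', ha, hb]
    · linear_combination (a.imK / 2) * h2 - (a.imJ / 2) * h3
    · linear_combination (a.imI / 2) * h3 - (a.imK / 2) * h1
    · linear_combination (a.imJ / 2) * h1 - (a.imI / 2) * h2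
  refine ⟨(Quaternion.normSq a)⁻¹ * (-(a * b).re), ?_⟩
  rw [mul_smul, ← key, smul_smul, inv_mul_cancel₀ hN, one_smul]

theorem commute_of_im_mul_eq_zero {a b : ℍ[ℝ]} (ha : a.re = 0) (hb : b.re = 0)
    (h : (a * b).im = 0) : a * b = b * a := by
  have h1 := congrArg QuaternionAlgebra.imI h
  have h2 := congrArg QuaternionAlgebra.imJ h
  have h3 := congrArg QuaternionAlgebra.imK h
  simp [ha, hb] at h1 h2 h3
  ext <;> simp [ha, hb]
  · ring
  · linear_combination 2 * h1
  · linear_combination 2 * h2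
  · linear_combination 2 * h3

/-- A vector whose triple product with two independent vectors vanishes is in their span. -/
theorem exists_eq_add_of_triple_eq_zero {a b c : ℍ[ℝ]} (ha : a.re = 0) (hb : b.re = 0)
    (hc : c.re = 0) (hab : a * b ≠ b * a) (h : (a * b * c).re = 0) :
    ∃ l m : ℝ, c = l • a + m • b := by
  have hN : Quaternion.normSq (a * b).im ≠ 0 := by
    rw [Ne, Quaternion.normSq_eq_zero]
    exact fun h0 => hab (commute_of_im_mul_eq_zero ha hb h0)
  have key : Quaternion.normSq (a * b).im • c =
      ((a * c).re * (b * b).re - (b * c).re * (a * b).re) • a +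
        ((b * c).re * (a * a).re - (a * c).re * (a * b).re) • b := by
    simp [ha, hb, hc] at h
    ext <;> simp [Quaternion.normSq_def', ha, hb, hc]
    · linear_combination (-(a.imJ * b.imK - a.imK * b.imJ)) * h
    · linear_combination (-(a.imK * b.imI - a.imI * b.imK)) * h
    · linear_combination (-(a.imI * b.imJ - a.imJ * b.imI)) * h
  refine ⟨(Quaternion.normSq (a * b).im)⁻¹ *
      ((a * c).re * (b * b).re - (b * c).re * (a * b).re),
    (Quaternion.normSq (a * b).im)⁻¹ *
      ((b * c).re * (a * a).re - (a * c).re * (a * b).re), ?_⟩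
  rw [mul_smul, mul_smul, ← smul_add, ← key, smul_smul, inv_mul_cancel₀ hN, one_smul]

/-! ### Circles and the quaternionic cross ratio -/

/-- The product of the sides of a plane quadrangle with sides `a`, `b`, `c` and `-(a + b + c)`. -/
theorem im_prod_of_eq_add {a b c : ℍ[ℝ]} (ha : a.re = 0) (hb : b.re = 0) {l m : ℝ}
    (hc : c = l • a + m • b) :
    (a * b * c * (-(a + b + c))).im =
      (-(c * (a + b + c)).re + (a * b).re * (m - l)) • (a * b).im := by
  subst hc
  ext <;> simp [ha, hb] <;> ring

/-- The imaginary part of the product of the sides of a quadrangle detects whether the quadrangle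
is plane, provided that its diagonal `a + b` does not vanish. -/
theorem re_im_prod_mul_add {a b c : ℍ[ℝ]} (ha : a.re = 0) (hb : b.re = 0) (hc : c.re = 0) :
    ((a * b * c * (-(a + b + c))).im * (a + b)).re =
      (a * b * c).re * Quaternion.normSq (a + b) := by
  simp [Quaternion.normSq_def', ha, hb, hc]
  ring

theorem OnCircle.subset {s t : Set E3} (h : OnCircle t) (hst : s ⊆ t) : OnCircle s :=
  h.imp (fun h => h.subset hst) (fun h => h.subset hst)

theorem cospherical_of_not_collinear {p q r : E3} (h : ¬ Collinear ℝ {p, q, r}) :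
    EuclideanGeometry.Cospherical ({p, q, r} : Set E3) := by
  let T : Affine.Triangle ℝ E3 := ⟨![p, q, r], affineIndependent_iff_not_collinear_set.2 h⟩
  refine ⟨T.circumcenter, T.circumradius, ?_⟩
  rintro x (rfl | rfl | rfl)
  · exact T.dist_circumcenter_eq_circumradius 0
  · exact T.dist_circumcenter_eq_circumradius 1
  · exact T.dist_circumcenter_eq_circumradius 2

theorem onCircle_triple (p q r : E3) : OnCircle {p, q, r} := by
  by_cases h : Collinear ℝ ({p, q, r} : Set E3)
  · exact Or.inr h
  · exact Or.inl ⟨cospherical_of_not_collinear h, coplanar_triple ℝ p q r⟩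

theorem triple_eq_zero_of_coplanar {y₀ y₁ y₂ y₃ : E3}
    (h : Coplanar ℝ ({y₀, y₁, y₂, y₃} : Set E3)) :
    ((vecQuat y₁ - vecQuat y₀) * (vecQuat y₂ - vecQuat y₁) * (vecQuat y₃ - vecQuat y₂)).re
      = 0 := by
  set S := vectorSpan ℝ ({y₀, y₁, y₂, y₃} : Set E3) with hS
  have h2 : Module.finrank ℝ S ≤ 2 := h.finrank_le_two
  have h3 : Module.finrank ℝ S + Module.finrank ℝ Sᗮ = 3 := by
    rw [S.finrank_add_finrank_orthogonal]; simp
  have h4 : Sᗮ ≠ ⊥ := by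
    intro hb
    rw [hb, finrank_bot] at h3
    omega
  obtain ⟨m, hm, hm0⟩ := Submodule.exists_mem_ne_zero_of_ne_bot h4
  have e : ∀ p ∈ ({y₀, y₁, y₂, y₃} : Set E3), ∀ q ∈ ({y₀, y₁, y₂, y₃} : Set E3),
      (p 0 - q 0) * m 0 + (p 1 - q 1) * m 1 + (p 2 - q 2) * m 2 = 0 := by
    intro p hp q hq
    have := (Submodule.mem_orthogonal _ _).1 hm _ (vsub_mem_vectorSpan ℝ hp hq)
    rw [PiLp.inner_apply, Fin.sum_univ_three] at this
    simp at this
    linear_combination this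
  have e1 := e y₁ (by simp) y₀ (by simp)
  have e2 := e y₂ (by simp) y₁ (by simp)
  have e3 := e y₃ (by simp) y₂ (by simp)
  have hdet : (!![y₁ 0 - y₀ 0, y₁ 1 - y₀ 1, y₁ 2 - y₀ 2;
      y₂ 0 - y₁ 0, y₂ 1 - y₁ 1, y₂ 2 - y₁ 2;
      y₃ 0 - y₂ 0, y₃ 1 - y₂ 1, y₃ 2 - y₂ 2] : Matrix (Fin 3) (Fin 3) ℝ).det = 0 := by
    rw [← Matrix.exists_mulVec_eq_zero_iff]
    refine ⟨![m 0, m 1, m 2], ?_, ?_⟩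
    · intro h0
      apply hm0
      ext i
      fin_cases i
      · exact congrFun h0 0
      · exact congrFun h0 1
      · exact congrFun h0 2
    · ext i
      fin_cases i <;> simp [Matrix.mulVec, dotProduct, Fin.sum_univ_three] <;> assumption
  rw [Matrix.det_fin_three] at hdet
  simp at hdet
  simp
  linear_combination -hdet

/-- Four points of space, consecutive ones distinct, lie on a circle or a straight line if and
only if the product of the consecutive difference vectors in the quaternions is real. Up to a real
factor this product is the quaternionic cross ratio. -/
theorem onCircle_iff_im_eq_zero {y₀ y₁ y₂ y₃ : E3} (h01 : y₀ ≠ y₁) (h12 : y₁ ≠ y₂) :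
    OnCircle {y₀, y₁, y₂, y₃} ↔
      ((vecQuat y₁ - vecQuat y₀) * (vecQuat y₂ - vecQuat y₁) * (vecQuat y₃ - vecQuat y₂) *
        (vecQuat y₀ - vecQuat y₃)).im = 0 := by
  set a := vecQuat y₁ - vecQuat y₀ with ha
  set b := vecQuat y₂ - vecQuat y₁ with hb
  set c := vecQuat y₃ - vecQuat y₂ with hc
  have hd : vecQuat y₀ - vecQuat y₃ = -(a + b + c) := by rw [ha, hb, hc]; abel
  rw [hd]
  have ra : a.re = 0 := by simp [ha]
  have rb : b.re = 0 := by simp [hb]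
  have rc : c.re = 0 := by simp [hc]
  have ha0 : a ≠ 0 := by
    rw [ha, sub_ne_zero]; exact fun h => h01 (vecQuat_injective h).symm
  have hb0 : b ≠ 0 := by
    rw [hb, sub_ne_zero]; exact fun h => h12 (vecQuat_injective h).symm
  -- the squared distances of the four points from `o`, in terms of `y₁ - o`
  have dist0 : ∀ o, dist y₀ o ^ 2 = Quaternion.normSq (vecQuat y₁ - vecQuat o - a) := by
    intro o; rw [← normSq_vecQuat_sub, ha]; congr 1; abel
  have dist1 : ∀ o, dist y₁ o ^ 2 = Quaternion.normSq (vecQuat y₁ - vecQuat o) := by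
    intro o; rw [← normSq_vecQuat_sub]
  have dist2 : ∀ o, dist y₂ o ^ 2 = Quaternion.normSq (vecQuat y₁ - vecQuat o + b) := by
    intro o; rw [← normSq_vecQuat_sub, hb]; congr 1; abel
  have dist3 : ∀ o, dist y₃ o ^ 2 = Quaternion.normSq (vecQuat y₁ - vecQuat o + b + c) := by
    intro o; rw [← normSq_vecQuat_sub, hb, hc]; congr 1; abel
  -- when `c = l a + m b`, the factor in `im_prod_of_eq_add` measures by how much the fourth
  -- point misses a sphere through the first three
  have power : ∀ (o : E3) (l m : ℝ), c = l • a + m • b → dist y₀ o = dist y₁ o →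
      dist y₂ o = dist y₁ o →
      dist y₃ o ^ 2 - dist y₁ o ^ 2 = -(c * (a + b + c)).re + (a * b).re * (m - l) := by
    intro o l m hlm h0 h2
    have h0' := dist0 o
    have h2' := dist2 o
    rw [h0, dist1] at h0'
    rw [h2, dist1] at h2'
    rw [dist3, dist1, hlm]
    have rz : (vecQuat y₁ - vecQuat o).re = 0 := by simp
    generalize vecQuat y₁ - vecQuat o = z at h0' h2' rz
    simp [Quaternion.normSq_def', ra, rb, rz] at h0' h2' ⊢
    linear_combination l * h0' - (1 + m) * h2'
  have collinear_of : ∀ k l : ℝ, b = k • a → c = l • a →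
      Collinear ℝ ({y₀, y₁, y₂, y₃} : Set E3) := by
    intro k l hk hl
    rw [collinear_iff_of_mem (p₀ := y₀) (by simp)]
    refine ⟨y₁ - y₀, ?_⟩
    rintro p (rfl | rfl | rfl | rfl)
    · exact ⟨0, by simp⟩
    · exact ⟨1, by simp⟩
    · refine ⟨1 + k, vecQuat_injective ?_⟩
      rw [vadd_eq_add, vecQuat_add, vecQuat_smul, vecQuat_sub, ← ha, add_smul, ← hk, hb, ha]
      simp
    · refine ⟨1 + k + l, vecQuat_injective ?_⟩
      rw [vadd_eq_add, vecQuat_add, vecQuat_smul, vecQuat_sub, ← ha, add_smul, add_smul, ← hk,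
        ← hl, hc, hb, ha]
      simp
  constructor
  · rintro (h | h)
    · have ht := triple_eq_zero_of_coplanar h.Coplanar
      obtain ⟨o, ρ, ho⟩ := h.Cospherical
      have o0 := ho y₀ (by simp)
      have o1 := ho y₁ (by simp)
      have o2 := ho y₂ (by simp)
      have o3 := ho y₃ (by simp)
      by_cases hab : a * b = b * a
      · obtain ⟨k, hk⟩ := exists_smul_of_commute ra rb ha0 hab
        have d0 := dist0 o
        have d2 := dist2 o
        rw [o0, ← o1, dist1] at d0
        rw [o2, ← o1, dist1, hk] at d2
        have hk0 : k ≠ 0 := by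
          rintro rfl
          exact hb0 (by rw [hk, zero_smul])
        -- a line meets a sphere at most twice, so the first and third points coincide
        have hk1 : k * (1 + k) * Quaternion.normSq a = 0 := by
          have rz : (vecQuat y₁ - vecQuat o).re = 0 := by simp
          generalize vecQuat y₁ - vecQuat o = z at d0 d2 rz
          simp [Quaternion.normSq_def', ra, rz, -mul_eq_zero] at d0 d2 ⊢
          linear_combination (-k) * d0 - d2
        have hk2 : 1 + k = 0 := by
          simpa [hk0, Quaternion.normSq_eq_zero, ha0] using hk1
        have : a + b = 0 := by
          rw [hk]; nth_rewrite 1 [← one_smul ℝ a]; rw [← add_smul, hk2, zero_smul]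
        rw [this, zero_add, hk]
        ext <;> simp [ra, rc] <;> ring_nf <;> simp
      · obtain ⟨l, m, hlm⟩ := exists_eq_add_of_triple_eq_zero ra rb rc hab ht
        rw [im_prod_of_eq_add ra rb hlm, ← power o l m hlm (o0.trans o1.symm) (o2.trans o1.symm),
          o3, o1, sub_self, zero_smul]
    · rw [collinear_iff_of_mem (p₀ := y₀) (by simp)] at h
      obtain ⟨e, he⟩ := h
      obtain ⟨t1, h1⟩ := he y₁ (by simp)
      obtain ⟨t2, h2⟩ := he y₂ (by simp)
      obtain ⟨t3, h3⟩ := he y₃ (by simp)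
      have ha' : a = t1 • vecQuat e := by
        rw [ha, h1, vadd_eq_add, vecQuat_add, vecQuat_smul]; abel
      have hb' : b = (t2 - t1) • vecQuat e := by
        rw [hb, h1, h2, vadd_eq_add, vadd_eq_add, vecQuat_add, vecQuat_add, vecQuat_smul,
          vecQuat_smul, sub_smul]; abel
      have hc' : c = (t3 - t2) • vecQuat e := by
        rw [hc, h2, h3, vadd_eq_add, vadd_eq_add, vecQuat_add, vecQuat_add, vecQuat_smul,
          vecQuat_smul, sub_smul]; abel
      rw [ha', hb', hc']
      ext <;> simp <;> ring_nf <;> simp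
  · intro h
    by_cases h02 : y₀ = y₂
    · subst h02
      exact (onCircle_triple y₀ y₁ y₃).subset (by simp [Set.insert_subset_iff])
    have hab0 : a + b ≠ 0 := by
      rw [ha, hb, sub_add_sub_cancel', sub_ne_zero]
      exact fun h => h02 (vecQuat_injective h).symm
    have ht : (a * b * c).re = 0 := by
      have := re_im_prod_mul_add ra rb rc
      rw [h] at this
      simpa [Quaternion.normSq_eq_zero, hab0] using this.symm
    by_cases hab : a * b = b * a
    · obtain ⟨k, hk⟩ := exists_smul_of_commute ra rb ha0 hab
      right
      have hk1 : 1 + k ≠ 0 := by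
        intro hk1
        apply hab0
        rw [hk]; nth_rewrite 1 [← one_smul ℝ a]; rw [← add_smul, hk1, zero_smul]
      have hk0 : k ≠ 0 := by
        rintro rfl
        exact hb0 (by rw [hk, zero_smul])
      have e : (a * b * c * (-(a + b + c))).im =
          (-(k * (1 + k) * Quaternion.normSq a)) • (a * c).im := by
        rw [hk]
        ext <;> simp [Quaternion.normSq_def', ra, rc] <;> ring
      rw [e, smul_eq_zero] at h
      have h' : (a * c).im = 0 := by
        refine h.resolve_left ?_
        simp [hk0, hk1, ha0]
      obtain ⟨l, hl⟩ := exists_smul_of_commute ra rc ha0 (commute_of_im_mul_eq_zero ra rc h')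
      exact collinear_of k l hk hl
    · obtain ⟨l, m, hlm⟩ := exists_eq_add_of_triple_eq_zero ra rb rc hab ht
      have hnc : ¬ Collinear ℝ ({y₀, y₁, y₂} : Set E3) := by
        intro hcol
        rw [collinear_iff_of_mem (p₀ := y₀) (by simp)] at hcol
        obtain ⟨e, he⟩ := hcol
        obtain ⟨t1, h1⟩ := he y₁ (by simp)
        obtain ⟨t2, h2⟩ := he y₂ (by simp)
        apply hab
        rw [ha, hb, h1, h2, vadd_eq_add, vadd_eq_add, vecQuat_add, vecQuat_add, vecQuat_smul,
          vecQuat_smul]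
        ext <;> simp <;> ring_nf <;> simp
      obtain ⟨o, ρ, ho⟩ := cospherical_of_not_collinear hnc
      have o0 := ho y₀ (by simp)
      have o1 := ho y₁ (by simp)
      have o2 := ho y₂ (by simp)
      rw [im_prod_of_eq_add ra rb hlm, ← power o l m hlm (o0.trans o1.symm) (o2.trans o1.symm),
        smul_eq_zero] at h
      have h' := h.resolve_right fun h' => hab (commute_of_im_mul_eq_zero ra rb h')
      left
      refine ⟨⟨o, ρ, ?_⟩, ?_⟩
      · have o3 : dist y₃ o = ρ := by
          rw [← o1]
          exact (pow_left_inj₀ dist_nonneg dist_nonneg two_ne_zero).1 (sub_eq_zero.1 h')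
        rintro p (rfl | rfl | rfl | rfl) <;> assumption
      · have hmem : y₃ ∈ affineSpan ℝ ({y₀, y₁, y₂} : Set E3) := by
          have : y₃ = (l • (y₁ - y₀) + m • (y₂ - y₁)) +ᵥ y₂ := by
            apply vecQuat_injective
            rw [vadd_eq_add, vecQuat_add, vecQuat_add, vecQuat_smul, vecQuat_smul, vecQuat_sub,
              vecQuat_sub, ← ha, ← hb, ← hlm, hc]
            abel
          rw [this]
          apply AffineSubspace.vadd_mem_of_mem_direction _ (mem_affineSpan ℝ (by simp))
          rw [direction_affineSpan]
          exact add_mem (Submodule.smul_mem _ _ (vsub_mem_vectorSpan ℝ (by simp) (by simp)))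
            (Submodule.smul_mem _ _ (vsub_mem_vectorSpan ℝ (by simp) (by simp)))
        have := (coplanar_insert_iff_of_mem_affineSpan hmem).2 (coplanar_triple ℝ y₀ y₁ y₂)
        exact this.subset (by simp [Set.insert_subset_iff])

/-! ### Lines in space and their incidence -/

/-- The straight line through `p` with direction `d` (for `d ≠ 0`). -/
noncomputable def line (p d : E3) : AffineSubspace ℝ E3 :=
  AffineSubspace.mk' p (Submodule.span ℝ {d})

theorem mem_line {p d q : E3} : q ∈ line p d ↔ ∃ t : ℝ, q = p + t • d := by
  rw [line, AffineSubspace.mem_mk', Submodule.mem_span_singleton]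
  constructor
  · rintro ⟨t, ht⟩
    exact ⟨t, by rw [ht]; simp⟩
  · rintro ⟨t, rfl⟩
    exact ⟨t, by simp⟩

theorem self_mem_line (p d : E3) : p ∈ line p d := mem_line.2 ⟨0, by simp⟩

theorem isLine_line (p : E3) {d : E3} (hd : d ≠ 0) : IsLine (line p d) :=
  ⟨⟨p, self_mem_line p d⟩, by rw [line, AffineSubspace.direction_mk', finrank_span_singleton hd]⟩

theorem IsLine.exists_eq_line {u : AffineSubspace ℝ E3} (h : IsLine u) {p : E3} (hp : p ∈ u) :
    ∃ d, d ≠ 0 ∧ u = line p d := by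
  obtain ⟨d, hd, hspan⟩ := finrank_eq_one_iff'.1 h.2
  refine ⟨d, by simpa using hd, ?_⟩
  refine (AffineSubspace.mk'_eq hp).symm.trans (congrArg (AffineSubspace.mk' p) ?_)
  refine le_antisymm (fun x hx => ?_) ?_
  · obtain ⟨c, hc⟩ := hspan ⟨x, hx⟩
    exact Submodule.mem_span_singleton.2 ⟨c, congrArg Subtype.val hc⟩
  · rw [Submodule.span_singleton_le_iff_mem]
    exact d.2

theorem line_eq_of_mem {p q d : E3} (h : q ∈ line p d) : line p d = line q d := by
  have := AffineSubspace.mk'_eq h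
  rw [line, AffineSubspace.direction_mk'] at this
  exact this.symm

theorem line_smul (p : E3) {d : E3} {k : ℝ} (hk : k ≠ 0) : line p (k • d) = line p d := by
  rw [line, line, Submodule.span_singleton_smul_eq (IsUnit.mk0 k hk)]

theorem line_eq_of_mem_of_mem {p q x d : E3} (hp : p ∈ line x d) (hq : q ∈ line x d)
    (hpq : p ≠ q) : line x d = line p (q - p) := by
  rw [line_eq_of_mem hp] at hq ⊢
  obtain ⟨t, rfl⟩ := mem_line.1 hq
  have ht : t ≠ 0 := by
    rintro rfl
    simp at hpq
  rw [add_sub_cancel_left, line_smul p ht]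

/-- Two affine subspaces have a point in common or are parallel. For straight lines this is
incidence in the projective closure. -/
def Meets (u v : AffineSubspace ℝ E3) : Prop :=
  ((u : Set E3) ∩ (v : Set E3)).Nonempty ∨ u.Parallel v

/-- Up to the factor `-2`, the triple product of three vectors, written with the commutator of
quaternions in place of the cross product. -/
noncomputable def tripleProd (d w z : E3) : ℝ :=
  (vecQuat d * (vecQuat w * vecQuat z - vecQuat z * vecQuat w)).re

theorem tripleProd_eq (d w z : E3) : tripleProd d w z =
    -2 * (d 0 * (w 1 * z 2 - w 2 * z 1) + d 1 * (w 2 * z 0 - w 0 * z 2) +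
      d 2 * (w 0 * z 1 - w 1 * z 0)) := by
  simp [tripleProd]
  ring

theorem parallel_line_iff {p d q w : E3} (hd : d ≠ 0) :
    (line p d).Parallel (line q w) ↔ ∃ k : ℝ, k ≠ 0 ∧ d = k • w := by
  rw [AffineSubspace.parallel_iff_direction_eq_and_eq_bot_iff_eq_bot]
  have hb : ∀ p d, line p d ≠ ⊥ := fun p d =>
    (AffineSubspace.nonempty_iff_ne_bot _).1 ⟨p, self_mem_line p d⟩
  simp only [hb, iff_self, and_true]
  rw [line, line, AffineSubspace.direction_mk', AffineSubspace.direction_mk']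
  constructor
  · intro h
    have : d ∈ Submodule.span ℝ {w} := h ▸ Submodule.mem_span_singleton_self d
    obtain ⟨k, hk⟩ := Submodule.mem_span_singleton.1 this
    refine ⟨k, ?_, hk.symm⟩
    rintro rfl
    exact hd (by rw [← hk, zero_smul])
  · rintro ⟨k, hk, rfl⟩
    rw [Submodule.span_singleton_smul_eq (IsUnit.mk0 k hk)]

theorem exists_smul_of_vecQuat_commute {a b : E3} (ha : a ≠ 0)
    (h : vecQuat a * vecQuat b = vecQuat b * vecQuat a) : ∃ k : ℝ, b = k • a := by
  obtain ⟨k, hk⟩ := exists_smul_of_commute (vecQuat_re a) (vecQuat_re b)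
    (mt vecQuat_eq_zero_iff.1 ha) h
  exact ⟨k, vecQuat_injective (by rw [hk, vecQuat_smul])⟩

/-- Two straight lines meet, possibly at infinity, if and only if the triple product of their
directions and a vector joining them vanishes. -/
theorem meets_line_iff {p d q w : E3} (hd : d ≠ 0) (hw : w ≠ 0) :
    Meets (line p d) (line q w) ↔ tripleProd d w (p - q) = 0 := by
  constructor
  · rintro (⟨x, hx, hx'⟩ | h)
    · obtain ⟨s, rfl⟩ := mem_line.1 hx
      obtain ⟨t, ht⟩ := mem_line.1 hx'
      have : p - q = t • w - s • d := by
        rw [sub_eq_sub_iff_add_eq_add, ht, add_comm]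
      rw [this, tripleProd_eq]
      simp
      ring
    · obtain ⟨k, -, rfl⟩ := (parallel_line_iff hd).1 h
      rw [tripleProd_eq]
      simp
      ring
  · intro h
    by_cases hc : vecQuat w * vecQuat d = vecQuat d * vecQuat w
    · obtain ⟨k, rfl⟩ := exists_smul_of_vecQuat_commute hw hc
      exact Or.inr ((parallel_line_iff hd).2 ⟨k, by rintro rfl; simp at hd, rfl⟩)
    · left
      -- `w × (p - q)` and `w × d` are both orthogonal to `w` and to `d`, hence parallel
      obtain ⟨k, hk⟩ : ∃ k : ℝ, vecQuat w * vecQuat (p - q) - vecQuat (p - q) * vecQuat w =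
          k • (vecQuat w * vecQuat d - vecQuat d * vecQuat w) := by
        apply exists_smul_of_commute _ _ (sub_ne_zero.2 hc)
        · rw [tripleProd_eq] at h
          generalize p - q = z at h
          ext <;> simp
          · ring
          · linear_combination (4 * w 0) * h
          · linear_combination (4 * w 1) * h
          · linear_combination (4 * w 2) * h
        · simp; ring
        · simp; ring
      obtain ⟨s, hs⟩ : ∃ s : ℝ, p - q - k • d = s • w := by
        apply exists_smul_of_vecQuat_commute hw
        rw [vecQuat_sub (p - q), vecQuat_smul, mul_sub, sub_mul, mul_smul_comm, smul_mul_assoc]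
        rw [smul_sub, sub_eq_sub_iff_add_eq_add] at hk
        rw [sub_eq_sub_iff_add_eq_add, hk, add_comm]
      refine ⟨q + s • w, mem_line.2 ⟨-k, ?_⟩, mem_line.2 ⟨s, rfl⟩⟩
      rw [← hs, neg_smul]
      abel

theorem exists_ne_zero_orthogonal (m n : ℍ[ℝ]) :
    ∃ d : E3, d ≠ 0 ∧ (vecQuat d * m).re = 0 ∧ (vecQuat d * n).re = 0 := by
  let f : E3 →ₗ[ℝ] ℝ × ℝ :=
    { toFun := fun d => ((vecQuat d * m).re, (vecQuat d * n).re)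
      map_add' := fun x y => by
        ext <;> simp only [vecQuat_add, add_mul, Quaternion.re_add, Prod.mk_add_mk]
      map_smul' := fun k x => by
        ext <;> simp only [vecQuat_smul, smul_mul_assoc, Quaternion.re_smul, Prod.smul_mk,
          RingHom.id_apply] }
  have hker : LinearMap.ker f ≠ ⊥ := LinearMap.ker_ne_bot_of_finrank_lt (by simp)
  obtain ⟨d, hd, hd0⟩ := Submodule.exists_mem_ne_zero_of_ne_bot hker
  have := LinearMap.mem_ker.1 hd
  exact ⟨d, hd0, congrArg Prod.fst this, congrArg Prod.snd this⟩

/-- If two distinct lines `u`, `v` meet, possibly at infinity, then every family of lines having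
both as common transversals has a third one: any line of the pencil spanned by `u` and `v`. -/
theorem exists_third_transversal {ι : Type*} {x w : ι → E3} (hw : ∀ i, w i ≠ 0)
    {u v : AffineSubspace ℝ E3} (hu : IsLine u) (hv : IsLine v) (huv : u ≠ v) (hm : Meets u v)
    (hux : ∀ i, Meets u (line (x i) (w i))) (hvx : ∀ i, Meets v (line (x i) (w i))) :
    ∃ t, IsLine t ∧ t ≠ u ∧ t ≠ v ∧ ∀ i, Meets t (line (x i) (w i)) := by
  rcases hm with ⟨m, hmu, hmv⟩ | hpar
  · obtain ⟨a, ha, rfl⟩ := hu.exists_eq_line hmu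
    obtain ⟨b, hb, rfl⟩ := hv.exists_eq_line hmv
    have hne : ∀ k : ℝ, b ≠ k • a := by
      rintro k rfl
      refine huv (line_smul m ?_).symm
      rintro rfl
      simp at hb
    have hne' : ∀ k : ℝ, a ≠ k • b := by
      rintro k rfl
      refine huv (line_smul m ?_)
      rintro rfl
      simp at ha
    have hab : a + b ≠ 0 := fun h =>
      hne (-1) (by rw [neg_one_smul]; exact (neg_eq_of_add_eq_zero_right h).symm)
    have hmem : m + (a + b) ∈ line m (a + b) := mem_line.2 ⟨1, by simp⟩
    refine ⟨line m (a + b), isLine_line m hab, ?_, ?_, fun i => ?_⟩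
    · intro h
      rw [h] at hmem
      obtain ⟨k, hk⟩ := mem_line.1 hmem
      exact hne (k - 1) (by rw [sub_smul, ← add_left_cancel hk]; simp)
    · intro h
      rw [h] at hmem
      obtain ⟨k, hk⟩ := mem_line.1 hmem
      exact hne' (k - 1) (by rw [sub_smul, ← add_left_cancel hk]; simp)
    · have h1 := (meets_line_iff ha (hw i)).1 (hux i)
      have h2 := (meets_line_iff hb (hw i)).1 (hvx i)
      rw [meets_line_iff hab (hw i)]
      rw [tripleProd_eq] at h1 h2 ⊢
      simp only [PiLp.add_apply]
      linear_combination h1 + h2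
  · obtain ⟨p, hp⟩ := hu.1
    obtain ⟨q, hq⟩ := hv.1
    obtain ⟨a, ha, rfl⟩ := hu.exists_eq_line hp
    obtain ⟨b, hb, rfl⟩ := hv.exists_eq_line hq
    obtain ⟨k, hk, rfl⟩ := (parallel_line_iff ha).1 hpar
    rw [line_smul p hk] at *
    set c : E3 := (1 / 2 : ℝ) • (p + q) with hc
    have hcc : q = c + (c - p) := by
      rw [hc]; module
    refine ⟨line c b, isLine_line c hb, ?_, ?_, fun i => ?_⟩
    · intro h
      apply huv
      have hcm : c ∈ line p b := h ▸ self_mem_line c b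
      obtain ⟨t, ht⟩ := mem_line.1 hcm
      apply line_eq_of_mem
      rw [mem_line]
      refine ⟨t + t, ?_⟩
      rw [hcc, ht]; module
    · intro h
      apply huv
      have hcm : c ∈ line q b := h ▸ self_mem_line c b
      obtain ⟨t, ht⟩ := mem_line.1 hcm
      symm
      apply line_eq_of_mem
      rw [mem_line]
      refine ⟨t + t, ?_⟩
      have : p = c + (c - q) := by rw [hc]; module
      rw [this, ht]; module
    · have h1 := (meets_line_iff hb (hw i)).1 (hux i)
      have h2 := (meets_line_iff hb (hw i)).1 (hvx i)
      rw [meets_line_iff hb (hw i)]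
      rw [tripleProd_eq] at h1 h2 ⊢
      simp [hc] at h1 h2 ⊢
      linear_combination (1 / 2 : ℝ) * h1 + (1 / 2 : ℝ) * h2

/-- If four lines have exactly two common transversals, then none of the four is one of them,
and no two of the four coincide. -/
theorem injective_of_transversals_eq_pair {x w : Fin 4 → E3} (hw : ∀ i, w i ≠ 0)
    {u v : AffineSubspace ℝ E3} (huv : u ≠ v)
    (h : {t | IsLine t ∧ ∀ i, Meets t (line (x i) (w i))} = {u, v}) :
    (∀ i, line (x i) (w i) ≠ u ∧ line (x i) (w i) ≠ v) ∧
      ∀ i j, i ≠ j → line (x i) (w i) ≠ line (x j) (w j) := by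
  have hmem : ∀ t, (IsLine t ∧ ∀ i, Meets t (line (x i) (w i))) ↔ t = u ∨ t = v := fun t =>
    Set.ext_iff.1 h t
  have hu := (hmem u).2 (Or.inl rfl)
  have hv := (hmem v).2 (Or.inr rfl)
  have symm : ∀ {s t : AffineSubspace ℝ E3}, Meets s t → Meets t s := fun h =>
    h.imp (fun h => Set.inter_comm _ _ ▸ h) (fun h => h.symm)
  have hnot : ¬ Meets u v := by
    intro hm
    obtain ⟨t, ht, htu, htv, hti⟩ := exists_third_transversal hw hu.1 hv.1 huv hm hu.2 hv.2
    exact ((hmem t).1 ⟨ht, hti⟩).elim htu htv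
  have hne : ∀ i, line (x i) (w i) ≠ u ∧ line (x i) (w i) ≠ v := fun i =>
    ⟨fun h => hnot (symm (h ▸ hv.2 i)), fun h => hnot (h ▸ hu.2 i)⟩
  refine ⟨hne, fun i j hij hL => ?_⟩
  obtain ⟨k, l, hkl⟩ : ∃ k l : Fin 4, ∀ m, m = i ∨ m = j ∨ m = k ∨ m = l := by
    clear hL; revert i j; decide
  -- through every point of the doubled line there passes a common transversal
  have key : ∀ p ∈ line (x i) (w i), p ∈ u ∨ p ∈ v := by
    intro p hp
    obtain ⟨d, hd, h1, h2⟩ := exists_ne_zero_orthogonal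
      (vecQuat (w k) * vecQuat (p - x k) - vecQuat (p - x k) * vecQuat (w k))
      (vecQuat (w l) * vecQuat (p - x l) - vecQuat (p - x l) * vecQuat (w l))
    have := (hmem (line p d)).1 ⟨isLine_line p hd, fun m => by
      rcases hkl m with rfl | rfl | rfl | rfl
      · exact Or.inl ⟨p, self_mem_line p d, hp⟩
      · exact Or.inl ⟨p, self_mem_line p d, hL ▸ hp⟩
      · exact (meets_line_iff hd (hw _)).2 h1
      · exact (meets_line_iff hd (hw _)).2 h2⟩
    rcases this with e | e
    · exact Or.inl (e ▸ self_mem_line p d)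
    · exact Or.inr (e ▸ self_mem_line p d)
  -- two of them on the same transversal make the doubled line a transversal
  have two : ∀ t : AffineSubspace ℝ E3, IsLine t → ∀ p ∈ line (x i) (w i),
      ∀ q ∈ line (x i) (w i), p ≠ q → p ∈ t → q ∈ t → line (x i) (w i) = t := by
    intro t ht p hp q hq hpq hpt hqt
    obtain ⟨d, -, rfl⟩ := ht.exists_eq_line hpt
    rw [line_eq_of_mem_of_mem hp hq hpq, line_eq_of_mem_of_mem hpt hqt hpq]
  have hp : ∀ c : ℝ, x i + c • w i ∈ line (x i) (w i) := fun c => mem_line.2 ⟨c, rfl⟩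
  have hpne : ∀ {c c' : ℝ}, c ≠ c' → x i + c • w i ≠ x i + c' • w i := fun hc h =>
    hc (smul_left_injective ℝ (hw i) (add_left_cancel h))
  have hU : ∀ {c c' : ℝ}, c ≠ c' → x i + c • w i ∈ u → x i + c' • w i ∈ u → False :=
    fun hc h h' => (hne i).1 (two u hu.1 _ (hp _) _ (hp _) (hpne hc) h h')
  have hV : ∀ {c c' : ℝ}, c ≠ c' → x i + c • w i ∈ v → x i + c' • w i ∈ v → False :=
    fun hc h h' => (hne i).2 (two v hv.1 _ (hp _) _ (hp _) (hpne hc) h h')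
  have n01 : (0 : ℝ) ≠ 1 := by norm_num
  have n02 : (0 : ℝ) ≠ 2 := by norm_num
  have n12 : (1 : ℝ) ≠ 2 := by norm_num
  rcases key _ (hp 0) with h0 | h0 <;> rcases key _ (hp 1) with h1 | h1 <;>
    rcases key _ (hp 2) with h2 | h2
  · exact hU n01 h0 h1
  · exact hU n01 h0 h1
  · exact hU n02 h0 h2
  · exact hV n12 h1 h2
  · exact hU n12 h1 h2
  · exact hV n02 h0 h2
  · exact hV n01 h0 h1
  · exact hV n01 h0 h1

/-! ### Quaternion quadrangles -/

theorem re_mul_comm (p q : ℍ[ℝ]) : (p * q).re = (q * p).re := by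
  simp; ring

theorem re_im_mul {p q : ℍ[ℝ]} (hq : q.re = 0) : (p.im * q).re = (p * q).re := by
  simp [hq]

theorem im_commute {p q : ℍ[ℝ]} (h : p * q = q * p) : p.im * q = q * p.im := by
  have e : p.im = p - (p.re : ℍ[ℝ]) := eq_sub_of_add_eq' (Quaternion.re_add_im p)
  rw [e, sub_mul, mul_sub, h, Quaternion.coe_commutes]

theorem mul_eq_neg_mul_of_re {p q : ℍ[ℝ]} (hp : p.re = 0) (hq : q.re = 0) (h : (p * q).re = 0) :
    q * p = -(p * q) := by
  simp [hp, hq] at h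
  ext <;> simp [hp, hq]
  · linear_combination 2 * h
  · ring
  · ring
  · ring

/-- If `v` intertwines `p` and `-q`, then `q` is the mirror image of `p` in the plane orthogonal
to `v`. -/
theorem exists_sub_eq_smul {v p q : ℍ[ℝ]} (hv : v.re = 0) (hp : p.re = 0) (hv0 : v ≠ 0)
    (h : v * q = -(p * v)) :
    ∃ s : ℝ, q - p = s • v ∧ s * Quaternion.normSq v = 2 * (p * v).re := by
  have hN : Quaternion.normSq v ≠ 0 := Quaternion.normSq_ne_zero.2 hv0
  have e1 : Quaternion.normSq v • q = v * (p * v) := by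
    have : v * (v * q) = -(v * (p * v)) := by rw [h, mul_neg]
    rw [← mul_assoc, mul_self_of_re hv, Quaternion.coe_mul_eq_smul, neg_smul, neg_inj] at this
    exact this
  have e2 : v * (p * v) = Quaternion.normSq v • p + (2 * (p * v).re) • v := by
    ext <;> simp [Quaternion.normSq_def', hv, hp] <;> ring
  refine ⟨(Quaternion.normSq v)⁻¹ * (2 * (p * v).re), ?_, ?_⟩
  · have : Quaternion.normSq v • (q - p) = (2 * (p * v).re) • v := by
      rw [smul_sub, e1, e2, add_sub_cancel_left]
    rw [mul_smul, ← this, smul_smul, inv_mul_cancel₀ hN, one_smul]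
  · field_simp

theorem coeff_eq_zero_of_triple_ne_zero {a b c : ℍ[ℝ]} (ha : a.re = 0) (hb : b.re = 0)
    (hc : c.re = 0) (h : (a * b * c).re ≠ 0) {k l m : ℝ} (e : k • a + l • b + m • c = 0) :
    k = 0 ∧ l = 0 ∧ m = 0 := by
  refine ⟨?_, ?_, ?_⟩ <;> refine (mul_eq_zero.1 (?_ : _ * (a * b * c).re = 0)).resolve_right h
  · have : ((k • a + l • b + m • c) * b * c).re = 0 := by rw [e]; simp
    simp [ha, hb, hc, -mul_eq_zero] at this ⊢
    linear_combination this
  · have : (a * (k • a + l • b + m • c) * c).re = 0 := by rw [e]; simp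
    simp [ha, hb, hc, -mul_eq_zero] at this ⊢
    linear_combination this
  · have : (a * b * (k • a + l • b + m • c)).re = 0 := by rw [e]; simp
    simp [ha, hb, hc, -mul_eq_zero] at this ⊢
    linear_combination this

/-- In a plane quadrangle with sides `a`, `b`, `c` and `-(a + b + c)`, the imaginary part of the
product of the sides is orthogonal to the plane. -/
theorem re_im_prod_mul_eq_zero {a b c : ℍ[ℝ]} (ha : a.re = 0) (hb : b.re = 0)
    (hc : c.re = 0) (h : (a * b * c).re = 0) :
    ((a * b * c * (-(a + b + c))).im * a).re = 0 ∧
      ((a * b * c * (-(a + b + c))).im * b).re = 0 ∧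
      ((a * b * c * (-(a + b + c))).im * c).re = 0 := by
  simp [ha, hb, hc] at h
  refine ⟨?_, ?_, ?_⟩
  · simp [ha, hb, hc]
    linear_combination (a.imI ^ 2 + a.imJ ^ 2 + a.imK ^ 2) * h
  · simp [ha, hb, hc]
    linear_combination (b.imI ^ 2 + b.imJ ^ 2 + b.imK ^ 2 +
      2 * (a.imI * b.imI + a.imJ * b.imJ + a.imK * b.imK)) * h
  · simp [ha, hb, hc]
    linear_combination (c.imI ^ 2 + c.imJ ^ 2 + c.imK ^ 2 +
      2 * (a.imI * c.imI + a.imJ * c.imJ + a.imK * c.imK) +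
      2 * (b.imI * c.imI + b.imJ * c.imJ + b.imK * c.imK)) * h

theorem prod_star_mul_mul (P v : Fin 4 → ℍ[ℝ]) :
    (star (P 0) * v 0 * P 1) * (star (P 1) * v 1 * P 2) * (star (P 2) * v 2 * P 3) *
      (star (P 3) * v 3 * P 0) =
    (Quaternion.normSq (P 1) * Quaternion.normSq (P 2) * Quaternion.normSq (P 3)) •
      (star (P 0) * (v 0 * v 1 * v 2 * v 3) * P 0) := by
  calc _ = star (P 0) * v 0 * (P 1 * star (P 1)) * v 1 * (P 2 * star (P 2)) * v 2 *
        (P 3 * star (P 3)) * v 3 * P 0 := by simp only [mul_assoc]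
    _ = _ := by
      simp only [Quaternion.self_mul_star, Quaternion.mul_coe_eq_smul, smul_mul_assoc,
        mul_smul_comm, smul_smul, mul_assoc]

/-- If the product of the sides `v i` is real, the four vectors `star (P i) * v i * P (i + 1)` are
orthogonal to a common direction: their product is real as well, so that the first two and the
last two of them span the same plane or are two pairs of parallel vectors. -/
theorem exists_common_orthogonal {P v : Fin 4 → ℍ[ℝ]} (hP : ∀ i, P i ≠ 0) (hv : ∀ i, v i ≠ 0)
    (hn : ∀ i, (star (P i) * v i * P (i + 1)).re = 0) (hV : (v 0 * v 1 * v 2 * v 3).im = 0) :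
    ∃ d : E3, d ≠ 0 ∧ ∀ i, (vecQuat d * (star (P i) * v i * P (i + 1))).re = 0 := by
  have hn0 : ∀ i, star (P i) * v i * P (i + 1) ≠ 0 := fun i =>
    mul_ne_zero (mul_ne_zero (star_ne_zero.2 (hP i)) (hv i)) (hP (i + 1))
  have hprod : ∃ R : ℝ, (star (P 0) * v 0 * P (0 + 1)) * (star (P 1) * v 1 * P (1 + 1)) *
      (star (P 2) * v 2 * P (2 + 1)) * (star (P 3) * v 3 * P (3 + 1)) = (R : ℍ[ℝ]) := by
    obtain ⟨ρ, hρ⟩ : ∃ ρ : ℝ, v 0 * v 1 * v 2 * v 3 = (ρ : ℍ[ℝ]) :=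
      ⟨(v 0 * v 1 * v 2 * v 3).re, by
        conv_lhs => rw [← Quaternion.re_add_im (v 0 * v 1 * v 2 * v 3)]
        rw [hV, add_zero]⟩
    refine ⟨Quaternion.normSq (P 1) * Quaternion.normSq (P 2) * Quaternion.normSq (P 3) *
      (ρ * Quaternion.normSq (P 0)), (prod_star_mul_mul P v).trans ?_⟩
    rw [hρ, ← Quaternion.coe_commutes, mul_assoc ((ρ : ℝ) : ℍ[ℝ]), Quaternion.star_mul_self,
      ← Quaternion.coe_mul, ← Quaternion.coe_smul, smul_eq_mul]
  generalize hN : (fun i => star (P i) * v i * P (i + 1)) = n at *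
  have hN' : ∀ i, star (P i) * v i * P (i + 1) = n i := fun i => congrFun hN i
  simp only [hN'] at *
  obtain ⟨R, hR⟩ := hprod
  have hR0 : R ≠ 0 := by
    rintro rfl
    have := mul_ne_zero (mul_ne_zero (mul_ne_zero (hn0 0) (hn0 1)) (hn0 2)) (hn0 3)
    exact this (by rw [hR, Quaternion.coe_zero])
  -- multiply by `n 3 * n 2` from the right; squares of imaginary quaternions are real
  have hκ : (Quaternion.normSq (n 2) * Quaternion.normSq (n 3)) • (n 0 * n 1) =
      R • (n 3 * n 2) := by
    calc _ = n 0 * n 1 * (n 2 * (n 3 * n 3) * n 2) := by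
          rw [mul_self_of_re (hn 3), Quaternion.mul_coe_eq_smul, smul_mul_assoc,
            mul_self_of_re (hn 2), mul_smul_comm, Quaternion.mul_coe_eq_smul, smul_smul]
          congr 1
          ring
      _ = (n 0 * n 1 * n 2 * n 3) * (n 3 * n 2) := by simp only [mul_assoc]
      _ = _ := by rw [hR, Quaternion.coe_mul_eq_smul]
  have hκ0 : Quaternion.normSq (n 2) * Quaternion.normSq (n 3) ≠ 0 :=
    mul_ne_zero (Quaternion.normSq_ne_zero.2 (hn0 2)) (Quaternion.normSq_ne_zero.2 (hn0 3))
  have hκim : (Quaternion.normSq (n 2) * Quaternion.normSq (n 3)) • (n 0 * n 1).im =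
      R • (n 3 * n 2).im := by
    rw [← Quaternion.im_smul, hκ, Quaternion.im_smul]
  have orth : ∀ {a b : ℍ[ℝ]}, a.re = 0 → b.re = 0 →
      ((a * b).im * a).re = 0 ∧ ((a * b).im * b).re = 0 := by
    intro a b ha hb
    constructor <;> simp [ha, hb] <;> ring
  by_cases h01 : (n 0 * n 1).im = 0
  · obtain ⟨d, hd, h0, h3⟩ := exists_ne_zero_orthogonal (n 0) (n 3)
    obtain ⟨k, hk⟩ := exists_smul_of_commute (hn 0) (hn 1) (hn0 0)
      (commute_of_im_mul_eq_zero (hn 0) (hn 1) h01)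
    have h32 : (n 3 * n 2).im = 0 := by
      rw [h01, smul_zero] at hκim
      exact (smul_eq_zero.1 hκim.symm).resolve_left hR0
    obtain ⟨l, hl⟩ := exists_smul_of_commute (hn 3) (hn 2) (hn0 3)
      (commute_of_im_mul_eq_zero (hn 3) (hn 2) h32)
    refine ⟨d, hd, fun i => ?_⟩
    fin_cases i
    · exact h0
    · change (vecQuat d * n 1).re = 0
      rw [hk, mul_smul_comm, Quaternion.re_smul, h0, smul_zero]
    · change (vecQuat d * n 2).re = 0
      rw [hl, mul_smul_comm, Quaternion.re_smul, h3, smul_zero]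
    · exact h3
  · obtain ⟨d, hd⟩ := exists_vecQuat_eq (q := (n 0 * n 1).im) (by simp)
    have h32 : ∀ q : ℍ[ℝ], ((n 3 * n 2).im * q).re = 0 → ((n 0 * n 1).im * q).re = 0 := by
      intro q hq
      have := congrArg (fun r : ℍ[ℝ] => (r * q).re) hκim
      simp only [smul_mul_assoc, Quaternion.re_smul, hq, smul_eq_mul, mul_zero] at this
      exact (mul_eq_zero.1 this).resolve_left hκ0
    refine ⟨d, ?_, fun i => ?_⟩
    · rintro rfl
      exact h01 (hd.symm.trans (vecQuat_eq_zero_iff.2 rfl))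
    · rw [hd]
      fin_cases i
      · exact (orth (hn 0) (hn 1)).1
      · exact (orth (hn 0) (hn 1)).2
      · exact h32 _ (orth (hn 3) (hn 2)).2
      · exact h32 _ (orth (hn 3) (hn 2)).1

/-- Rotating the direction `d` of a common transversal by the four quaternions `P i` produces
directions of which consecutive ones are mirror images in the planes orthogonal to the sides of
the quadrangle `y i`. If the product of the sides is not real, then all these reflections displace
by the same multiple of the side, which makes the Study parameter vectors pairwise conjugate. -/
theorem re_mul_star_mul_sub_eq_zero {P y : Fin 4 → ℍ[ℝ]} (hP : ∀ i, P i ≠ 0)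
    (hy : ∀ i, (y i).re = 0) (hv : ∀ i, y (i + 1) - y i ≠ 0)
    (hn : ∀ i, (star (P i) * (y (i + 1) - y i) * P (i + 1)).re = 0)
    {d : ℍ[ℝ]} (hd : d.re = 0) (hd0 : d ≠ 0)
    (hdn : ∀ i, (d * (star (P i) * (y (i + 1) - y i) * P (i + 1))).re = 0)
    (hV : ((y 1 - y 0) * (y 2 - y 1) * (y 3 - y 2) * (y 0 - y 3)).im ≠ 0) (i j : Fin 4) :
    (P i * star (P j) * (y i - y j)).re = 0 := by
  -- the images of the direction `d`
  set δ : Fin 4 → ℍ[ℝ] := fun i => P i * d * (P i)⁻¹ with hδ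
  have δP : ∀ i, δ i * P i = P i * d := fun i => inv_mul_cancel_right₀ (hP i) _
  have hδre : ∀ i, (δ i).re = 0 := by
    intro i
    rw [hδ]
    change (P i * d * (P i)⁻¹).re = 0
    rw [re_mul_comm, inv_mul_cancel_left₀ (hP i), hd]
  have Pδ : ∀ i, star (P i) * δ i = d * star (P i) := by
    intro i
    have := congrArg star (δP i)
    rw [star_mul (δ i), star_mul (P i) d, star_eq_neg_of_re (hδre i), star_eq_neg_of_re hd,
      mul_neg, neg_mul, neg_inj] at this
    exact this
  have hδ0 : δ 0 ≠ 0 := mul_ne_zero (mul_ne_zero (hP 0) hd0) (inv_ne_zero (hP 0))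
  have hvre : ∀ i, (y (i + 1) - y i).re = 0 := fun i => by simp [hy]
  have anti : ∀ i, (y (i + 1) - y i) * δ (i + 1) = -(δ i * (y (i + 1) - y i)) := by
    intro i
    apply mul_left_cancel₀ (star_ne_zero.2 (hP i))
    apply mul_right_cancel₀ (hP (i + 1))
    calc _ = star (P i) * (y (i + 1) - y i) * (δ (i + 1) * P (i + 1)) := by
          simp only [mul_assoc]
      _ = (star (P i) * (y (i + 1) - y i) * P (i + 1)) * d := by rw [δP]; simp only [mul_assoc]
      _ = -(d * (star (P i) * (y (i + 1) - y i) * P (i + 1))) :=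
          mul_eq_neg_mul_of_re hd (hn i) (hdn i)
      _ = -((d * star (P i)) * (y (i + 1) - y i) * P (i + 1)) := by simp only [mul_assoc]
      _ = _ := by rw [← Pδ]; simp only [mul_assoc, mul_neg, neg_mul]
  choose s hs hs' using fun i => exists_sub_eq_smul (hvre i) (hδre i) (hv i) (anti i)
  have hs0 : δ 1 - δ 0 = s 0 • (y 1 - y 0) := hs 0
  have hs1 : δ 2 - δ 1 = s 1 • (y 2 - y 1) := hs 1
  have hs2 : δ 3 - δ 2 = s 2 • (y 3 - y 2) := hs 2
  have hs3 : δ 0 - δ 3 = s 3 • (y 0 - y 3) := hs 3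
  have re0 : (y 1 - y 0).re = 0 := hvre 0
  have re1 : (y 2 - y 1).re = 0 := hvre 1
  have re2 : (y 3 - y 2).re = 0 := hvre 2
  have hd3 : y 0 - y 3 = -((y 1 - y 0) + (y 2 - y 1) + (y 3 - y 2)) := by abel
  have hs_const : s 0 = s 3 ∧ s 1 = s 3 ∧ s 2 = s 3 := by
    by_cases ht : ((y 1 - y 0) * (y 2 - y 1) * (y 3 - y 2)).re = 0
    · -- the image directions are orthogonal to the plane of the quadrangle, so all of them agree
      rw [hd3] at hV
      obtain ⟨o0, o1, o2⟩ := re_im_prod_mul_eq_zero re0 re1 re2 ht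
      rw [← hd3] at hV o0 o1 o2
      have hcomm : ((y 1 - y 0) * (y 2 - y 1) * (y 3 - y 2) * (y 0 - y 3)) * δ 0 =
          δ 0 * ((y 1 - y 0) * (y 2 - y 1) * (y 3 - y 2) * (y 0 - y 3)) := by
        have a0 : (y 1 - y 0) * δ 1 = -(δ 0 * (y 1 - y 0)) := anti 0
        have a1 : (y 2 - y 1) * δ 2 = -(δ 1 * (y 2 - y 1)) := anti 1
        have a2 : (y 3 - y 2) * δ 3 = -(δ 2 * (y 3 - y 2)) := anti 2
        have a3 : (y 0 - y 3) * δ 0 = -(δ 3 * (y 0 - y 3)) := anti 3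
        rw [mul_assoc, a3, mul_neg, ← mul_assoc, mul_assoc (_ * _) _ (δ 3), a2, mul_neg, neg_mul,
          ← mul_assoc, mul_assoc (y 1 - y 0) _ (δ 2), a1, mul_neg, ← mul_assoc, a0]
        simp only [neg_mul, neg_neg, mul_assoc]
      obtain ⟨k, hk⟩ := exists_smul_of_commute (by simp) (hδre 0) hV (im_commute hcomm)
      have orth : ∀ q, (((y 1 - y 0) * (y 2 - y 1) * (y 3 - y 2) * (y 0 - y 3)).im * q).re = 0 →
          (δ 0 * q).re = 0 := by
        intro q hq
        rw [hk, smul_mul_assoc, Quaternion.re_smul, hq, smul_zero]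
      have step : ∀ i, δ i = δ 0 → (δ 0 * (y (i + 1) - y i)).re = 0 →
          s i = 0 ∧ δ (i + 1) = δ 0 := by
        intro i hi h0
        have h1 := hs' i
        rw [hi, h0, mul_zero] at h1
        have h2 := (mul_eq_zero.1 h1).resolve_right (Quaternion.normSq_ne_zero.2 (hv i))
        refine ⟨h2, ?_⟩
        have h3 := hs i
        rw [h2, zero_smul, sub_eq_zero, hi] at h3
        exact h3
      obtain ⟨z0, e1⟩ := step 0 rfl (orth _ o0)
      obtain ⟨z1, e2⟩ := step 1 e1 (orth _ o1)
      obtain ⟨z2, e3⟩ := step 2 e2 (orth _ o2)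
      have z3 : s 3 = 0 := by
        refine (step 3 e3 ?_).1
        change (δ 0 * (y 0 - y 3)).re = 0
        rw [hd3, mul_neg, mul_add, mul_add, Quaternion.re_neg, Quaternion.re_add,
          Quaternion.re_add, orth _ o0, orth _ o1, orth _ o2]
        simp
      exact ⟨z0.trans z3.symm, z1.trans z3.symm, z2.trans z3.symm⟩
    · have hsum : (s 0 - s 3) • (y 1 - y 0) + (s 1 - s 3) • (y 2 - y 1) +
          (s 2 - s 3) • (y 3 - y 2) = 0 := by
        have e : (δ 1 - δ 0) + (δ 2 - δ 1) + (δ 3 - δ 2) + (δ 0 - δ 3) = 0 := by abel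
        rw [hs0, hs1, hs2, hs3, hd3] at e
        rw [← e]
        module
      obtain ⟨h0, h1, h2⟩ := coeff_eq_zero_of_triple_ne_zero re0 re1 re2 ht hsum
      exact ⟨sub_eq_zero.1 h0, sub_eq_zero.1 h1, sub_eq_zero.1 h2⟩
  obtain ⟨c0, c1, c2⟩ := hs_const
  have hsub : ∀ i, δ i - δ 0 = s 3 • (y i - y 0) := by
    intro i
    rw [c0] at hs0
    rw [c1] at hs1
    rw [c2] at hs2
    fin_cases i
    · change δ 0 - δ 0 = s 3 • (y 0 - y 0)
      simp
    · exact hs0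
    · change δ 2 - δ 0 = s 3 • (y 2 - y 0)
      rw [← sub_add_sub_cancel (δ 2) (δ 1), hs0, hs1, ← smul_add, sub_add_sub_cancel]
    · change δ 3 - δ 0 = s 3 • (y 3 - y 0)
      rw [← sub_add_sub_cancel (δ 3) (δ 2), ← sub_add_sub_cancel (δ 2) (δ 1) (δ 0), hs0, hs1, hs2,
        ← smul_add, ← smul_add, sub_add_sub_cancel, sub_add_sub_cancel]
  have hsub' : δ i - δ j = s 3 • (y i - y j) := by
    rw [← sub_sub_sub_cancel_right (δ i) (δ j) (δ 0), hsub, hsub, ← smul_sub,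
      sub_sub_sub_cancel_right]
  have hQj : P i * star (P j) * δ j = P i * d * star (P j) := by
    rw [mul_assoc, Pδ, mul_assoc]
  have hQi : δ i * (P i * star (P j)) = P i * d * star (P j) := by
    rw [← mul_assoc, δP]
  by_cases hs3z : s 3 = 0
  · -- all relative displacements preserve the direction `δ 0`, and the images of the point lie in
    -- a plane orthogonal to it
    have hδeq : ∀ i, δ i = δ 0 := by
      intro i
      have := hsub i
      rwa [hs3z, zero_smul, sub_eq_zero] at this
    have hs_all : ∀ i, s i = 0 := by
      intro i
      fin_cases i
      · exact c0.trans hs3z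
      · exact c1.trans hs3z
      · exact c2.trans hs3z
      · exact hs3z
    have orth : ∀ i, (δ 0 * (y (i + 1) - y i)).re = 0 := by
      intro i
      have := hs' i
      rw [hs_all, zero_mul, hδeq] at this
      linarith
    have hyδ : ∀ i, (δ 0 * y i).re = (δ 0 * y 0).re := by
      have o0 : (δ 0 * (y 1 - y 0)).re = 0 := orth 0
      have o1 : (δ 0 * (y 2 - y 1)).re = 0 := orth 1
      have o2 : (δ 0 * (y 3 - y 2)).re = 0 := orth 2
      rw [mul_sub, Quaternion.re_sub] at o0 o1 o2
      intro i
      fin_cases i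
      · rfl
      · change (δ 0 * y 1).re = _; linarith
      · change (δ 0 * y 2).re = _; linarith
      · change (δ 0 * y 3).re = _; linarith
    rw [hδeq] at hQi hQj
    obtain ⟨k, hk⟩ := exists_smul_of_commute (hδre 0) (by simp) hδ0
      (im_commute (hQj.trans hQi.symm)).symm
    rw [← re_im_mul (by simp [hy]), hk, smul_mul_assoc, Quaternion.re_smul, mul_sub,
      Quaternion.re_sub, hyδ i, hyδ j, sub_self, smul_zero]
  · have : s 3 * (P i * star (P j) * (y i - y j)).re = 0 := by
      rw [← smul_eq_mul, ← Quaternion.re_smul, ← mul_smul_comm, ← hsub', mul_sub,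
        Quaternion.re_sub, re_mul_comm _ (δ i), hQi, hQj, sub_self]
    exact (mul_eq_zero.1 this).resolve_left hs3z

/-! ### Study parameters and relative axes -/

theorem IsStudyVector.vecQuat_mul {A : ℍ[ℝ] × ℍ[ℝ]} {σ : E3 ≃ᵃⁱ[ℝ] E3} (h : IsStudyVector A σ)
    (x : E3) : vecQuat (σ x) * A.1 = A.1 * vecQuat x + (2 : ℝ) • A.2 := by
  have hN : Quaternion.normSq A.1 ≠ 0 := Quaternion.normSq_ne_zero.2 h.2.1
  apply smul_right_injective ℍ[ℝ] hN
  change Quaternion.normSq A.1 • (vecQuat (σ x) * A.1) = Quaternion.normSq A.1 • _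
  rw [← smul_mul_assoc, h.2.2 x, add_mul, mul_assoc, Quaternion.star_mul_self, smul_mul_assoc,
    mul_assoc A.2, Quaternion.star_mul_self, Quaternion.mul_coe_eq_smul, Quaternion.mul_coe_eq_smul,
    smul_add, smul_comm (2 : ℝ)]

theorem IsStudyVector.sub_mul {A : ℍ[ℝ] × ℍ[ℝ]} {σ : E3 ≃ᵃⁱ[ℝ] E3} (h : IsStudyVector A σ)
    (x x' : E3) : (vecQuat (σ x) - vecQuat (σ x')) * A.1 = A.1 * vecQuat (x - x') := by
  rw [_root_.sub_mul, h.vecQuat_mul, h.vecQuat_mul, vecQuat_sub, mul_sub]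
  abel

/-- The difference of two homologous images of a point, pulled back by the primal parts of the
Study parameters, is (up to a factor) the moment about the relative axis. -/
theorem star_mul_sub_mul {A B : ℍ[ℝ] × ℍ[ℝ]} {σ τ : E3 ≃ᵃⁱ[ℝ] E3} (hA : IsStudyVector A σ)
    (hB : IsStudyVector B τ) {x₀ : E3} (h0 : σ x₀ = τ x₀) {w : E3}
    (hw : vecQuat w = (star A.1 * B.1).im) (x : E3) :
    star A.1 * (vecQuat (τ x) - vecQuat (σ x)) * B.1 =
      vecQuat w * vecQuat (x - x₀) - vecQuat (x - x₀) * vecQuat w := by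
  have h1 := hB.sub_mul x x₀
  have h2 := congrArg star (hA.sub_mul x x₀)
  rw [star_mul (vecQuat (σ x) - vecQuat (σ x₀)), star_mul A.1, ← vecQuat_sub,
    star_eq_neg_of_re (vecQuat_re _), star_eq_neg_of_re (vecQuat_re _), mul_neg, neg_mul, neg_inj,
    vecQuat_sub (σ x)] at h2
  calc _ = star A.1 * ((vecQuat (τ x) - vecQuat (τ x₀)) * B.1) -
        star A.1 * (vecQuat (σ x) - vecQuat (σ x₀)) * B.1 := by
          rw [h0, ← mul_assoc, ← _root_.sub_mul, ← mul_sub, sub_sub_sub_cancel_right]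
    _ = star A.1 * B.1 * vecQuat (x - x₀) - vecQuat (x - x₀) * (star A.1 * B.1) := by
          rw [h1, h2]; simp only [mul_assoc]
    _ = _ := by
          rw [hw, ← Quaternion.sub_re_self, _root_.sub_mul, mul_sub, Quaternion.coe_commutes]
          abel

theorem mem_relAxis {α : Fin 4 → E3 ≃ᵃⁱ[ℝ] E3} {i : Fin 4} {x : E3} :
    x ∈ relAxis α i ↔ α i x = α (i + 1) x := by
  change (α (i + 1)) ((α i).symm (α i x)) = α i x ↔ _
  rw [AffineIsometryEquiv.symm_apply_apply, eq_comm]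

/-- The relative axes are the straight lines through a fixed point of the relative rotation, with
the direction given by the relative Study parameters. -/
theorem exists_relAxis_eq_line {α : Fin 4 → E3 ≃ᵃⁱ[ℝ] E3} (hα : IsRotationQuadrangle α)
    {A : Fin 4 → ℍ[ℝ] × ℍ[ℝ]} (hA : ∀ i, IsStudyVector (A i) (α i)) (i : Fin 4) :
    ∃ x w : E3, w ≠ 0 ∧ relAxis α i = line x w ∧ ∀ p,
      star (A i).1 * (vecQuat (α (i + 1) p) - vecQuat (α i p)) * (A (i + 1)).1 =
        vecQuat w * vecQuat (p - x) - vecQuat (p - x) * vecQuat w := by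
  obtain ⟨-, hne, y, hy⟩ := hα.2 i
  obtain ⟨x, rfl⟩ := (α i).surjective y
  have hx : α i x = α (i + 1) x := mem_relAxis.1 hy
  obtain ⟨w, hw⟩ := exists_vecQuat_eq (q := (star (A i).1 * (A (i + 1)).1).im) (by simp)
  have key := star_mul_sub_mul (hA i) (hA (i + 1)) hx hw
  have hzero : ∀ p, α i p = α (i + 1) p ↔
      vecQuat w * vecQuat (p - x) = vecQuat (p - x) * vecQuat w := by
    intro p
    rw [← sub_eq_zero (a := vecQuat w * _), ← key p]
    simp only [mul_eq_zero, star_eq_zero, (hA i).2.1, (hA (i + 1)).2.1, or_false, false_or,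
      sub_eq_zero, vecQuat_injective.eq_iff]
    exact eq_comm
  have hw0 : w ≠ 0 := by
    rintro rfl
    apply hne
    ext1 z
    obtain ⟨p, rfl⟩ := (α i).surjective z
    have : α i p = α (i + 1) p := by
      rw [hzero, vecQuat_eq_zero_iff.2 rfl, zero_mul, mul_zero]
    exact mem_relAxis.2 this
  refine ⟨x, w, hw0, ?_, key⟩
  ext p
  rw [mem_relAxis, hzero, mem_line]
  constructor
  · intro h
    obtain ⟨k, hk⟩ := exists_smul_of_vecQuat_commute hw0 h
    exact ⟨k, by rw [← hk]; abel⟩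
  · rintro ⟨k, rfl⟩
    rw [add_sub_cancel_left, vecQuat_smul, mul_smul_comm, smul_mul_assoc]

/-- Twice the polar form of the Study quadric, in terms of the images of an arbitrary point. -/
theorem two_mul_polar {A B : ℍ[ℝ] × ℍ[ℝ]} {σ τ : E3 ≃ᵃⁱ[ℝ] E3} (hA : IsStudyVector A σ)
    (hB : IsStudyVector B τ) (x : E3) :
    2 * ((A.1 * star B.2).re + (B.1 * star A.2).re) =
      (A.1 * star B.1 * (vecQuat (σ x) - vecQuat (τ x))).re := by
  have h1 : (2 : ℝ) • A.2 = vecQuat (σ x) * A.1 - A.1 * vecQuat x :=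
    eq_sub_of_add_eq' (hA.vecQuat_mul x).symm
  have h2 : (2 : ℝ) • B.2 = vecQuat (τ x) * B.1 - B.1 * vecQuat x :=
    eq_sub_of_add_eq' (hB.vecQuat_mul x).symm
  have e1 : 2 * (A.1 * star B.2).re = (A.1 * star ((2 : ℝ) • B.2)).re := by simp
  have e2 : 2 * (B.1 * star A.2).re = (B.1 * star ((2 : ℝ) • A.2)).re := by simp
  rw [mul_add, e1, e2, h1, h2]
  simp
  ring

/-- Pairwise conjugate points of the Study quadric span a subspace contained in it. -/
theorem span_subset_studyQuadric {A : Fin 4 → ℍ[ℝ] × ℍ[ℝ]}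
    (h : ∀ i j, ((A i).1 * star (A j).2).re + ((A j).1 * star (A i).2).re = 0) :
    (Submodule.span ℝ (Set.range A) : Set (ℍ[ℝ] × ℍ[ℝ])) ⊆ studyQuadric := by
  have key : ∀ a b : ℍ[ℝ] × ℍ[ℝ], a ∈ Submodule.span ℝ (Set.range A) →
      b ∈ Submodule.span ℝ (Set.range A) → (a.1 * star b.2).re + (b.1 * star a.2).re = 0 := by
    intro a b ha hb
    induction ha, hb using Submodule.span_induction₂ with
    | mem_mem a b ha hb =>
      obtain ⟨i, rfl⟩ := ha
      obtain ⟨j, rfl⟩ := hb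
      exact h i j
    | zero_left => simp
    | zero_right => simp
    | add_left x y z _ _ _ h1 h2 =>
      simp only [Prod.fst_add, Prod.snd_add, star_add, add_mul, mul_add, Quaternion.re_add]
      linarith
    | add_right x y z _ _ _ h1 h2 =>
      simp only [Prod.fst_add, Prod.snd_add, star_add, add_mul, mul_add, Quaternion.re_add]
      linarith
    | smul_left r x y _ _ h1 =>
      simp only [Prod.smul_fst, Prod.smul_snd, Quaternion.star_smul, smul_mul_assoc,
        mul_smul_comm, Quaternion.re_smul, ← smul_add, h1, smul_zero]
    | smul_right r x y _ _ h1 =>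
      simp only [Prod.smul_fst, Prod.smul_snd, Quaternion.star_smul, smul_mul_assoc,
        mul_smul_comm, Quaternion.re_smul, ← smul_add, h1, smul_zero]
  intro a ha
  have := key a a ha ha
  change (a.1 * star a.2).re = 0
  linarith

/-! ### The circle locus -/

theorem range_eq (f : Fin 4 → E3) : Set.range f = {f 0, f 1, f 2, f 3} := by
  ext x
  simp [Fin.exists_fin_succ, eq_comm]

theorem onCircle_range_of_eq {f : Fin 4 → E3} {i : Fin 4} (h : f i = f (i + 1)) :
    OnCircle (Set.range f) := by
  refine (onCircle_triple (f i) (f (i + 2)) (f (i + 3))).subset ?_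
  rintro _ ⟨j, rfl⟩
  have : j = i ∨ j = i + 1 ∨ j = i + 2 ∨ j = i + 3 := by
    clear h; revert i j; decide
  rcases this with rfl | rfl | rfl | rfl <;> simp [h]

theorem circleLocus_eq {α : Fin 4 → E3 ≃ᵃⁱ[ℝ] E3} (hα : IsRotationQuadrangle α)
    (hgen : IsGeneric α) :
    circleLocus α =
      (⋃ i, (relAxis α i : Set E3)) ∪ (⋃ u ∈ transversals α, (u : Set E3)) := by
  obtain ⟨A, hA, -, hq⟩ := hgen
  choose x w hw hL hn using exists_relAxis_eq_line hα hA
  have hP : ∀ i, (A i).1 ≠ 0 := fun i => (hA i).2.1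
  have hre : ∀ p i, (star (A i).1 * (vecQuat (α (i + 1) p) - vecQuat (α i p)) *
      (A (i + 1)).1).re = 0 := by
    intro p i
    rw [hn, Quaternion.re_sub, re_mul_comm, sub_self]
  have htrans : ∀ p d, d ≠ 0 → (line p d ∈ transversals α ↔
      ∀ i, (vecQuat d * (star (A i).1 * (vecQuat (α (i + 1) p) - vecQuat (α i p)) *
        (A (i + 1)).1)).re = 0) := by
    intro p d hd
    have : ∀ i, Meets (line p d) (relAxis α i) ↔ (vecQuat d * (star (A i).1 *
        (vecQuat (α (i + 1) p) - vecQuat (α i p)) * (A (i + 1)).1)).re = 0 := by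
      intro i
      rw [hL, meets_line_iff hd (hw i), hn]
      rfl
    simp only [← this]
    exact and_iff_right (isLine_line p hd)
  ext p
  simp only [Set.mem_union, Set.mem_iUnion, SetLike.mem_coe, exists_prop]
  by_cases hax : ∃ i, p ∈ relAxis α i
  · refine iff_of_true ?_ (Or.inl hax)
    obtain ⟨i, hi⟩ := hax
    exact onCircle_range_of_eq (f := fun i => α i p) (mem_relAxis.1 hi)
  have hne : ∀ i, α i p ≠ α (i + 1) p := fun i hi => hax ⟨i, mem_relAxis.2 hi⟩
  have hv : ∀ i, vecQuat (α (i + 1) p) - vecQuat (α i p) ≠ 0 := fun i h =>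
    hne i (vecQuat_injective (sub_eq_zero.1 h)).symm
  have hcirc : p ∈ circleLocus α ↔ ((vecQuat (α 1 p) - vecQuat (α 0 p)) *
      (vecQuat (α 2 p) - vecQuat (α 1 p)) * (vecQuat (α 3 p) - vecQuat (α 2 p)) *
      (vecQuat (α 0 p) - vecQuat (α 3 p))).im = 0 := by
    change OnCircle (Set.range fun i => α i p) ↔ _
    rw [range_eq]
    exact onCircle_iff_im_eq_zero (hne 0) (hne 1)
  rw [hcirc, or_iff_right hax]
  constructor
  · intro hV
    obtain ⟨d, hd, hdn⟩ := exists_common_orthogonal (P := fun i => (A i).1)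
      (v := fun i => vecQuat (α (i + 1) p) - vecQuat (α i p)) hP hv (hre p) hV
    exact ⟨line p d, (htrans p d hd).2 hdn, self_mem_line p d⟩
  · rintro ⟨u, hu, hpu⟩
    obtain ⟨d, hd, rfl⟩ := hu.1.exists_eq_line hpu
    by_contra hV
    apply hq
    apply span_subset_studyQuadric
    intro i j
    have h1 := re_mul_star_mul_sub_eq_zero (P := fun i => (A i).1)
      (y := fun i => vecQuat (α i p)) hP (fun i => vecQuat_re _) hv (hre p) (vecQuat_re d)
      (mt vecQuat_eq_zero_iff.1 hd) ((htrans p d hd).1 hu) hV i j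
    have h2 := two_mul_polar (hA i) (hA j) p
    linarith

end RotationQuadrangle

open RotationQuadrangle in
theorem mainTheorem1 (α : Fin 4 → E3 ≃ᵃⁱ[ℝ] E3) (hα : IsRotationQuadrangle α)
    (hgen : IsGeneric α) :
    circleLocus α = (⋃ i, (relAxis α i : Set E3)) ∪ (⋃ u ∈ transversals α, (u : Set E3)) ∧
    (∀ i, IsLine (relAxis α i)) ∧
    ∀ u v : AffineSubspace ℝ E3, u ≠ v → transversals α = {u, v} →
      Function.Injective ![relAxis α 0, relAxis α 1, relAxis α 2, relAxis α 3, u, v] ∧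
      circleLocus α =
        (relAxis α 0 : Set E3) ∪ (relAxis α 1 : Set E3) ∪ (relAxis α 2 : Set E3) ∪
          (relAxis α 3 : Set E3) ∪ (u : Set E3) ∪ (v : Set E3) := by
  have hlocus := circleLocus_eq hα hgen
  obtain ⟨A, hA, -, -⟩ := hgen
  choose x w hw hL _ using exists_relAxis_eq_line hα hA
  refine ⟨hlocus, fun i => hL i ▸ isLine_line _ (hw i), fun u v huv h => ⟨?_, ?_⟩⟩
  · have h' : {t | IsLine t ∧ ∀ i, Meets t (line (x i) (w i))} = {u, v} := by
      rw [← h]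
      simp only [← hL]
      rfl
    obtain ⟨hne, hinj⟩ := injective_of_transversals_eq_pair hw huv h'
    simp only [← hL] at hne hinj
    have e : ![relAxis α 0, relAxis α 1, relAxis α 2, relAxis α 3, u, v] =
        Fin.append (fun i : Fin 4 => relAxis α i) ![u, v] := by
      ext1 k
      fin_cases k <;> rfl
    rw [e, Fin.append_injective_iff]
    refine ⟨fun i j hij => by_contra fun hn => hinj i j hn hij, ?_, ?_⟩
    · intro i j hij
      fin_cases i <;> fin_cases j <;> first | rfl | exact absurd hij huv | exact absurd hij huv.symm
    · intro i j
      fin_cases j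
      · exact (hne i).1
      · exact (hne i).2
  · rw [hlocus, h, Set.biUnion_pair]
    ext p
    simp [Fin.exists_fin_succ, or_assoc]
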